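/- There is an absolute constant $C>0$ such that the following holds. Let $d,t\ge 1$ be integers, $\varepsilon>0$, and let $M$ be a real symmetric matrix with non-negative entries, with rows and columns indexed by $[d]^t$ (so that $M$ acts on $(\mathbb C^d)^{\otimes t}$), and with operator norm $\|M\|\le 1$. Put $$M(x)=\operatorname{Tr} M(xx^{T})^{\otimes t}=\sum_{\alpha,\beta\in[d]^t}M_{\alpha\beta}\prod_{r=1}^t x_{\alpha_r}x_{\beta_r},\qquad m=\max_{x\in\mathbb R^d,\ \|x\|=1}M(x).$$ A degree-$D$ pseudoexpectation is a linear functional $\widetilde{\mathbb E}$ on the real polynomials of degree at most $D$ in $x_1,\dots,x_d$ with $\widetilde{\mathbb E}[1]=1$ and $\widetilde{\mathbb E}[Q^2]\ge 0$ whenever $2\deg Q\le D$. Call $\nu\in\mathbb R$ feasible in degree $D$ if there is a degree-$D$ pseudoexpectation $\widetilde{\mathbb E}$ with $\widetilde{\mathbb E}[(M(x)-\nu)\,Q^2]\ge 0$ whenever $\deg (M(x)-\nu)+2\deg Q\le D$ and $\widetilde{\mathbb E}[(\|x\|^2-1)\,Q]=0$ whenever $2+\deg Q\le D$. Then for every integer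 $D\ge 2t$ with $D\ge C\,t^2\log d/\varepsilon^2$, the value $s=\sup\{\nu:\nu\text{ is feasible in degree }D\}$ of the degree-$D$ Sum-of-Squares relaxation is finite and satisfies $$m\le s\le m+\varepsilon .$$ Moreover, the degree-$D$ Sum-of-Squares algorithm approximates $m$ within additive error $\varepsilon$: start with the interval $[0,1]$ and repeat $n$ times: test whether the midpoint $\nu$ of the current interval is feasible in degree $D$, and replace the interval by its upper half if it is and by its lower half otherwise. If $2^{n}\ge 1/\varepsilon$, then the lower end $a$ of the last interval satisfies $|a-m|\le\varepsilon$. (For $d\ge 2$ and $\varepsilon\le 1$, the two lower bounds on $D$ are met by some $D=O(t^2\log d/\varepsilon^2)$.) -/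

import Mathlib

/-- The tensor power `A^{⊗ t}` of a `d × d` matrix, with rows and columns indexed by `[d]^t`. -/
def tensorPow {R : Type*} [CommSemiring R] {d : ℕ} (t : ℕ) (A : Matrix (Fin d) (Fin d) R) :
    Matrix (Fin t → Fin d) (Fin t → Fin d) R :=
  Matrix.of fun α β => ∏ r, A (α r) (β r)

/-- The objective `Tr M (x xᵀ)^{⊗ t}` at a real vector `x`. -/
def tensorObjective {d t : ℕ} (M : Matrix (Fin t → Fin d) (Fin t → Fin d) ℝ)
    (x : EuclideanSpace ℝ (Fin d)) : ℝ :=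
  (M * tensorPow t (Matrix.vecMulVec (fun i => x i) (fun i => x i))).trace

/-- The same objective `Tr M (x xᵀ)^{⊗ t}`, as a polynomial in the variables `x_1, …, x_d`. -/
noncomputable def objectivePoly {d t : ℕ} (M : Matrix (Fin t → Fin d) (Fin t → Fin d) ℝ) :
    MvPolynomial (Fin d) ℝ :=
  (M.map MvPolynomial.C *
    tensorPow t (Matrix.vecMulVec MvPolynomial.X MvPolynomial.X)).trace

/-- The sphere polynomial `‖x‖² - 1`. -/
noncomputable def spherePoly (d : ℕ) : MvPolynomial (Fin d) ℝ :=
  (∑ i, MvPolynomial.X i ^ 2) - 1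

/-- `E` is a degree-`D` pseudoexpectation. Only the values of `E` on polynomials of degree at most
`D` are constrained or used; a functional given on those polynomials alone extends linearly to
all polynomials, so nothing is lost by giving `E` the whole polynomial ring as its domain. -/
structure IsPseudoexpectation {d : ℕ} (D : ℕ) (E : MvPolynomial (Fin d) ℝ →ₗ[ℝ] ℝ) : Prop where
  map_one : E 1 = 1
  map_sq_nonneg : ∀ Q : MvPolynomial (Fin d) ℝ, 2 * Q.totalDegree ≤ D → 0 ≤ E (Q ^ 2)

/-- The degree-`D` pseudoexpectation `E` satisfies the constraint `P ≥ 0`. -/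
def SatisfiesNonneg {d : ℕ} (D : ℕ) (E : MvPolynomial (Fin d) ℝ →ₗ[ℝ] ℝ)
    (P : MvPolynomial (Fin d) ℝ) : Prop :=
  ∀ Q : MvPolynomial (Fin d) ℝ, P.totalDegree + 2 * Q.totalDegree ≤ D → 0 ≤ E (P * Q ^ 2)

/-- The degree-`D` pseudoexpectation `E` satisfies the constraint `P = 0`. -/
def SatisfiesZero {d : ℕ} (D : ℕ) (E : MvPolynomial (Fin d) ℝ →ₗ[ℝ] ℝ)
    (P : MvPolynomial (Fin d) ℝ) : Prop :=
  ∀ Q : MvPolynomial (Fin d) ℝ, P.totalDegree + Q.totalDegree ≤ D → E (P * Q) = 0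

/-- Feasibility of the degree-`D` Sum-of-Squares relaxation at the threshold `ν`: some degree-`D`
pseudoexpectation satisfies `Tr M (x xᵀ)^{⊗ t} ≥ ν` and `‖x‖² = 1`. -/
def SoSFeasible {d t : ℕ} (M : Matrix (Fin t → Fin d) (Fin t → Fin d) ℝ) (D : ℕ) (ν : ℝ) : Prop :=
  ∃ E : MvPolynomial (Fin d) ℝ →ₗ[ℝ] ℝ,
    IsPseudoexpectation D E ∧
    SatisfiesNonneg D E (objectivePoly M - MvPolynomial.C ν) ∧
    SatisfiesZero D E (spherePoly d)

open Classical in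
/-- Binary search for the threshold: the interval `(lo, hi)` reached from `(0, 1)` after `n`
feasibility tests of the degree-`D` Sum-of-Squares relaxation. -/
noncomputable def sosSearch {d t : ℕ} (M : Matrix (Fin t → Fin d) (Fin t → Fin d) ℝ) (D : ℕ) :
    ℕ → ℝ × ℝ
  | 0 => (0, 1)
  | n + 1 =>
    let I := sosSearch M D n
    let ν := (I.1 + I.2) / 2
    if SoSFeasible M D ν then (ν, I.2) else (I.1, ν)

/-- The output of the degree-`D` Sum-of-Squares algorithm that makes `n` feasibility tests: the
lower end of the last interval of the binary search. -/
noncomputable def sosAlgorithm {d t : ℕ} (M : Matrix (Fin t → Fin d) (Fin t → Fin d) ℝ)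
    (D n : ℕ) : ℝ :=
  (sosSearch M D n).1

/-! The numbers `E[x_i²]`, for words `i` of length at most `D / 2`, form a genuine law on words:
positivity makes them nonnegative, and the sphere constraint makes them sum to one with consistent
marginals. Commutativity makes the law exchangeable.

Condition on a prefix `i` of length `k`. Since the entries of `M` are nonnegative, the constraint
multiplied by `x_i²` and the pseudo-Cauchy–Schwarz inequality bound `ν` by the summed quadratic form
of `M` at the square roots of the joint masses (`le_sum_quadForm_sqrt_jointMass`). If the next `t`
letters were conditionally independent, those square roots would be a scaled tensor power of a unit
vector, of value at most `m` per unit of prefix mass (`quadForm_sqrt_productMass_le`).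

The error is twice the Hellinger distance to the product law, because `‖M‖ ≤ 1`, and the squared
Hellinger distance is at most the conditional total correlation (`sum_sq_sqrt_sub_sqrt_le`). Summed
over `k < K`, total correlations telescope to at most `t² log d`, so some prefix length makes the
error at most `ε` when `K ≥ 4 t² log d / ε²`. -/

section

open MvPolynomial

/-! ### Word monomials and the sphere relation -/

/-- The monomial `x_{i_1} ⋯ x_{i_k}` spelled by a word `i ∈ [d]^k`. -/
noncomputable def wordMonomial {d k : ℕ} (i : Fin k → Fin d) : MvPolynomial (Fin d) ℝ :=
  ∏ r, X (i r)

theorem totalDegree_wordMonomial_le {d k : ℕ} (i : Fin k → Fin d) :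
    (wordMonomial i).totalDegree ≤ k := by
  refine (totalDegree_finsetProd _ _).trans ?_
  simp

theorem wordMonomial_append {d k n : ℕ} (i : Fin k → Fin d) (α : Fin n → Fin d) :
    wordMonomial (Fin.append i α) = wordMonomial i * wordMonomial α := by
  simp [wordMonomial, Fin.prod_univ_add]

theorem sum_wordMonomial_sq (d n : ℕ) :
    ∑ α : Fin n → Fin d, wordMonomial α ^ 2 = (∑ a, (X a : MvPolynomial (Fin d) ℝ) ^ 2) ^ n := by
  rw [Fintype.sum_pow]
  simp [wordMonomial, Finset.prod_pow]

theorem totalDegree_sphere_le (d : ℕ) :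
    (∑ a, (X a : MvPolynomial (Fin d) ℝ) ^ 2).totalDegree ≤ 2 := by
  refine totalDegree_finsetSum_le fun a _ => ?_
  simp [totalDegree_X_pow]

theorem totalDegree_spherePoly_le (d : ℕ) : (spherePoly d).totalDegree ≤ 2 := by
  refine (totalDegree_sub _ _).trans (max_le (totalDegree_sphere_le d) (by simp))

theorem SatisfiesZero.map_mul_sphere_pow {d D : ℕ} {E : MvPolynomial (Fin d) ℝ →ₗ[ℝ] ℝ}
    (hE : SatisfiesZero D E (spherePoly d)) (n : ℕ) :
    ∀ q : MvPolynomial (Fin d) ℝ, q.totalDegree + 2 * n ≤ D →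
      E (q * (∑ a, X a ^ 2) ^ n) = E q := by
  induction n with
  | zero => intro q _; simp
  | succ n ih =>
    intro q hq
    have h1 : q * (∑ a, (X a : MvPolynomial (Fin d) ℝ) ^ 2) ^ (n + 1)
        = (q * ∑ a, X a ^ 2) * (∑ a, X a ^ 2) ^ n := by ring
    have h2 : (q * ∑ a, (X a : MvPolynomial (Fin d) ℝ) ^ 2).totalDegree ≤ q.totalDegree + 2 :=
      (totalDegree_mul _ _).trans (Nat.add_le_add_left (totalDegree_sphere_le d) _)
    have h3 := hE q (by have := totalDegree_spherePoly_le d; omega)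
    have h4 : q * (∑ a, (X a : MvPolynomial (Fin d) ℝ) ^ 2) = spherePoly d * q + q := by
      rw [spherePoly]; ring
    rw [h1, ih _ (by omega), h4, map_add, h3, zero_add]

/-! ### The law on words and its entropy -/

/-- The joint mass `E[x_i² x_α²]` of two words. -/
noncomputable def jointMass {d k n : ℕ} (E : MvPolynomial (Fin d) ℝ →ₗ[ℝ] ℝ)
    (i : Fin k → Fin d) (α : Fin n → Fin d) : ℝ :=
  E ((wordMonomial i * wordMonomial α) ^ 2)

/-- The mass `E[x_i²]` of a word. -/
noncomputable def wordMass {d k : ℕ} (E : MvPolynomial (Fin d) ℝ →ₗ[ℝ] ℝ)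
    (i : Fin k → Fin d) : ℝ :=
  E (wordMonomial i ^ 2)

/-- The mass `E[x_i² x_a²]` of a word followed by a letter. -/
noncomputable def letterMass {d k : ℕ} (E : MvPolynomial (Fin d) ℝ →ₗ[ℝ] ℝ)
    (i : Fin k → Fin d) (a : Fin d) : ℝ :=
  E ((wordMonomial i * X a) ^ 2)

/-- The Shannon entropy of the first `k` letters. -/
noncomputable def wordEntropy {d : ℕ} (E : MvPolynomial (Fin d) ℝ →ₗ[ℝ] ℝ) (k : ℕ) : ℝ :=
  ∑ i : Fin k → Fin d, Real.negMulLog (wordMass E i)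

section Mass

variable {d D k n : ℕ} {E : MvPolynomial (Fin d) ℝ →ₗ[ℝ] ℝ}

theorem jointMass_eq_wordMass_append (i : Fin k → Fin d) (α : Fin n → Fin d) :
    jointMass E i α = wordMass E (Fin.append i α) := by
  rw [jointMass, wordMass, wordMonomial_append]

theorem jointMass_const_one (i : Fin k → Fin d) (a : Fin d) :
    jointMass E i (fun _ : Fin 1 => a) = letterMass E i a := by
  simp [jointMass, letterMass, wordMonomial]

theorem wordMass_nonneg (hE : IsPseudoexpectation D E) (hk : 2 * k ≤ D) (i : Fin k → Fin d) :
    0 ≤ wordMass E i :=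
  hE.map_sq_nonneg _ (by have := totalDegree_wordMonomial_le i; omega)

theorem totalDegree_wordMonomial_mul_le (i : Fin k → Fin d) (α : Fin n → Fin d) :
    (wordMonomial i * wordMonomial α).totalDegree ≤ k + n := by
  rw [← wordMonomial_append]
  exact totalDegree_wordMonomial_le _

theorem jointMass_nonneg (hE : IsPseudoexpectation D E) (hk : 2 * (k + n) ≤ D)
    (i : Fin k → Fin d) (α : Fin n → Fin d) : 0 ≤ jointMass E i α := by
  rw [jointMass_eq_wordMass_append]
  exact wordMass_nonneg hE hk _

theorem letterMass_nonneg (hE : IsPseudoexpectation D E) (hk : 2 * (k + 1) ≤ D)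
    (i : Fin k → Fin d) (a : Fin d) : 0 ≤ letterMass E i a := by
  rw [← jointMass_const_one]
  exact jointMass_nonneg hE hk _ _

theorem sum_jointMass (hS : SatisfiesZero D E (spherePoly d)) (hk : 2 * (k + n) ≤ D)
    (i : Fin k → Fin d) : ∑ α : Fin n → Fin d, jointMass E i α = wordMass E i := by
  have h := hS.map_mul_sphere_pow n (wordMonomial i ^ 2) (by
    have := totalDegree_wordMonomial_le i
    have := totalDegree_pow (wordMonomial i) 2
    omega)
  rw [← sum_wordMonomial_sq, Finset.mul_sum, map_sum] at h
  simpa [jointMass, wordMass, mul_pow] using h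

theorem sum_letterMass (hS : SatisfiesZero D E (spherePoly d)) (hk : 2 * (k + 1) ≤ D)
    (i : Fin k → Fin d) : ∑ a, letterMass E i a = wordMass E i := by
  rw [← sum_jointMass (n := 1) hS hk i, ← (Equiv.funUnique (Fin 1) (Fin d)).symm.sum_comp]
  exact Finset.sum_congr rfl fun a _ => (jointMass_const_one i a).symm

theorem sum_wordMass (hE : IsPseudoexpectation D E) (hS : SatisfiesZero D E (spherePoly d))
    (hk : 2 * k ≤ D) : ∑ i : Fin k → Fin d, wordMass E i = 1 := by
  have h := sum_jointMass (k := 0) (n := k) hS (by omega) Fin.elim0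
  simpa [jointMass, wordMass, wordMonomial, hE.map_one] using h

theorem sum_append {n : ℕ} (f : (Fin (k + n) → Fin d) → ℝ) :
    ∑ i : Fin k → Fin d, ∑ α : Fin n → Fin d, f (Fin.append i α) = ∑ w, f w := by
  rw [← Fintype.sum_prod_type', ← (Fin.appendEquiv k n).sum_comp f]
  rfl

/-- Every position `r` has the same marginal: the variables commute, so the letter at `r` can be
moved next to the prefix and the others summed out by the sphere relation. -/
theorem sum_mul_jointMass_letter (hS : SatisfiesZero D E (spherePoly d)) (hk : 2 * (k + n) ≤ D)
    (i : Fin k → Fin d) (r : Fin n) (g : Fin d → ℝ) :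
    ∑ α : Fin n → Fin d, jointMass E i α * g (α r) = ∑ a, letterMass E i a * g a := by
  obtain ⟨n, rfl⟩ : ∃ n', n = n' + 1 := ⟨n - 1, by have := r.pos; omega⟩
  rw [← (Fin.insertNthEquiv (fun _ => Fin d) r).sum_comp, Fintype.sum_prod_type]
  refine Finset.sum_congr rfl fun a _ => ?_
  simp only [Fin.insertNthEquiv_apply, Fin.insertNth_apply_same]
  rw [← Finset.sum_mul]
  congr 1
  have h := hS.map_mul_sphere_pow n ((wordMonomial i * X a) ^ 2) (by
    have h1 := totalDegree_wordMonomial_le i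
    have h2 := totalDegree_pow (wordMonomial i * X a) 2
    have h3 := totalDegree_mul (wordMonomial i) (X a)
    rw [totalDegree_X] at h3
    omega)
  rw [← sum_wordMonomial_sq, Finset.mul_sum, map_sum] at h
  rw [letterMass, ← h]
  refine Finset.sum_congr rfl fun β _ => ?_
  rw [jointMass]
  congr 1
  have : wordMonomial (Fin.insertNthEquiv (fun _ => Fin d) r (a, β)) = X a * wordMonomial β := by
    simp [wordMonomial, Fin.prod_univ_succAbove _ r]
  rw [this]
  ring

theorem jointMass_le_wordMass (hE : IsPseudoexpectation D E)
    (hS : SatisfiesZero D E (spherePoly d)) (hk : 2 * (k + n) ≤ D)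
    (i : Fin k → Fin d) (α : Fin n → Fin d) : jointMass E i α ≤ wordMass E i := by
  rw [← sum_jointMass hS hk i]
  exact Finset.single_le_sum (fun β _ => jointMass_nonneg hE hk i β) (Finset.mem_univ α)

theorem jointMass_le_letterMass (hE : IsPseudoexpectation D E)
    (hS : SatisfiesZero D E (spherePoly d)) (hk : 2 * (k + n) ≤ D)
    (i : Fin k → Fin d) (α : Fin n → Fin d) (r : Fin n) :
    jointMass E i α ≤ letterMass E i (α r) := by
  -- The indicator of one letter turns the marginal identity into a sum of nonnegative terms
  -- containing the mass of `α`.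
  have h := sum_mul_jointMass_letter hS hk i r (fun a => if a = α r then 1 else 0)
  simp only [mul_ite, mul_one, mul_zero, Finset.sum_ite_eq', Finset.mem_univ, if_true] at h
  rw [← h]
  have := Finset.single_le_sum
    (f := fun β : Fin n → Fin d => if β r = α r then jointMass E i β else 0) (fun β _ => by
    split_ifs
    exacts [jointMass_nonneg hE hk i β, le_rfl]) (Finset.mem_univ α)
  simpa using this

theorem wordEntropy_add (k n : ℕ) :
    wordEntropy E (k + n) =
      ∑ i : Fin k → Fin d, ∑ α : Fin n → Fin d, Real.negMulLog (jointMass E i α) := by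
  simp only [jointMass_eq_wordMass_append]
  exact (sum_append (fun w => Real.negMulLog (wordMass E w))).symm

theorem wordEntropy_succ (k : ℕ) :
    wordEntropy E (k + 1) = ∑ i : Fin k → Fin d, ∑ a, Real.negMulLog (letterMass E i a) := by
  rw [wordEntropy_add]
  refine Finset.sum_congr rfl fun i _ => ?_
  rw [← (Equiv.funUnique (Fin 1) (Fin d)).symm.sum_comp]
  exact Finset.sum_congr rfl fun a _ => congrArg _ (jointMass_const_one i a)

theorem wordEntropy_zero (hE : IsPseudoexpectation D E) : wordEntropy E 0 = 0 := by
  simp [wordEntropy, wordMass, wordMonomial, hE.map_one]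

theorem wordEntropy_le_add (hE : IsPseudoexpectation D E)
    (hS : SatisfiesZero D E (spherePoly d)) (hk : 2 * (k + n) ≤ D) :
    wordEntropy E k ≤ wordEntropy E (k + n) := by
  rw [wordEntropy_add, wordEntropy]
  refine Finset.sum_le_sum fun i _ => ?_
  have h : Real.negMulLog (wordMass E i)
      = ∑ α : Fin n → Fin d, -(jointMass E i α * Real.log (wordMass E i)) := by
    rw [Finset.sum_neg_distrib, ← Finset.sum_mul, sum_jointMass hS hk, Real.negMulLog]
    ring
  rw [h]
  refine Finset.sum_le_sum fun α _ => ?_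
  rw [Real.negMulLog, neg_mul, neg_le_neg_iff]
  rcases (jointMass_nonneg hE hk i α).eq_or_lt with h0 | h0
  · simp [← h0]
  · exact mul_le_mul_of_nonneg_left (Real.log_le_log h0 (jointMass_le_wordMass hE hS hk i α)) h0.le

/-- Gibbs' inequality against the uniform law on the `d ^ k` words; the corrections `1 / N -
wordMass E i` sum to zero. -/
theorem wordEntropy_le (hd : 1 ≤ d) (hE : IsPseudoexpectation D E)
    (hS : SatisfiesZero D E (spherePoly d)) (hk : 2 * k ≤ D) :
    wordEntropy E k ≤ k * Real.log d := by
  have hd' : (0 : ℝ) < d := by exact_mod_cast hd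
  set N : ℝ := (d : ℝ) ^ k with hN
  have hN0 : 0 < N := by positivity
  have hlog : Real.log N = k * Real.log d := Real.log_pow d k
  have key : ∀ i : Fin k → Fin d,
      Real.negMulLog (wordMass E i) ≤ wordMass E i * Real.log N + (1 / N - wordMass E i) := by
    intro i
    rcases (wordMass_nonneg hE hk i).eq_or_lt with h0 | h0
    · rw [← h0]
      simp [hN0.le]
    · have h1 := Real.log_le_sub_one_of_pos (x := 1 / (N * wordMass E i)) (by positivity)
      rw [one_div, Real.log_inv, Real.log_mul hN0.ne' h0.ne'] at h1
      have h2 := mul_le_mul_of_nonneg_left h1 h0.le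
      have h3 : wordMass E i * ((N * wordMass E i)⁻¹ - 1) = 1 / N - wordMass E i := by
        field_simp
      rw [h3] at h2
      rw [Real.negMulLog]
      linarith
  refine (Finset.sum_le_sum fun i _ => key i).trans ?_
  rw [Finset.sum_add_distrib, Finset.sum_sub_distrib, ← Finset.sum_mul, sum_wordMass hE hS hk, hlog]
  simp [← hN, hN0.ne']

end Mass

/-! ### Telescoping of total correlations -/

/-- Telescoping bound for the sum of total correlations of blocks of length `t`. -/
theorem sum_total_correlation_le (H : ℕ → ℝ) (t K : ℕ) (h0 : H 0 = 0)
    (hmono : ∀ j < t, H K ≤ H (K + j)) :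
    ∑ k ∈ Finset.range K, (t * (H (k + 1) - H k) - (H (k + t) - H k))
      ≤ ∑ j ∈ Finset.range t, H j := by
  have h1 : ∑ k ∈ Finset.range K, (H (k + 1) - H k) = H K := by
    rw [Finset.sum_range_sub, h0, sub_zero]
  -- Splitting the first `K + t` values of `H` both ways gives the sum of `H (k + t) - H k` over `k
  -- < K` as that of `H (K + j) - H j` over `j < t`.
  have h2 := Finset.sum_range_add H K t
  have h3 := Finset.sum_range_add H t K
  rw [add_comm t K, h2] at h3
  have h4 : (t : ℝ) * H K ≤ ∑ j ∈ Finset.range t, H (K + j) := by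
    have := Finset.sum_le_sum fun j hj => hmono j (Finset.mem_range.1 hj)
    simpa using this
  rw [Finset.sum_sub_distrib, ← Finset.mul_sum, h1, Finset.sum_sub_distrib]
  simp only [add_comm t] at h3
  linarith

/-! ### Hellinger distance to the product law -/

/-- The mass of the law that, given the word `i`, draws independent letters with the conditional
law of a single letter. -/
noncomputable def productMass {d k n : ℕ} (E : MvPolynomial (Fin d) ℝ →ₗ[ℝ] ℝ)
    (i : Fin k → Fin d) (α : Fin n → Fin d) : ℝ :=
  wordMass E i * ∏ r, (letterMass E i (α r) / wordMass E i)

section Hellinger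

variable {d D k n : ℕ} {E : MvPolynomial (Fin d) ℝ →ₗ[ℝ] ℝ}

theorem productMass_nonneg (hE : IsPseudoexpectation D E) (hk : 2 * (k + 1) ≤ D)
    (i : Fin k → Fin d) (α : Fin n → Fin d) : 0 ≤ productMass E i α :=
  mul_nonneg (wordMass_nonneg hE (by omega) i) (Finset.prod_nonneg fun r _ =>
    div_nonneg (letterMass_nonneg hE hk i _) (wordMass_nonneg hE (by omega) i))

theorem sum_productMass (hS : SatisfiesZero D E (spherePoly d)) (hk : 2 * (k + 1) ≤ D)
    (i : Fin k → Fin d) : ∑ α : Fin n → Fin d, productMass E i α = wordMass E i := by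
  simp only [productMass]
  rw [← Finset.mul_sum, ← Fintype.sum_pow (fun a => letterMass E i a / wordMass E i) n,
    ← Finset.sum_div, sum_letterMass hS hk]
  by_cases h : wordMass E i = 0
  · simp [h]
  · simp [div_self h]

/-- This is `log z ≤ z - 1` at `z = √(q / p)`, the pointwise form of the bound of squared Hellinger
distance by relative entropy. -/
theorem two_mul_sub_sqrt_le {p q l : ℝ} (hp : 0 < p) (hq : 0 < q) (hl : l = Real.log q) :
    2 * (p - √p * √q) ≤ p * (Real.log p - l) := by
  subst hl
  have hp' := Real.sqrt_pos.2 hp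
  have hq' := Real.sqrt_pos.2 hq
  have h1 := Real.log_le_sub_one_of_pos (x := √q / √p) (by positivity)
  rw [Real.log_div hq'.ne' hp'.ne', Real.log_sqrt hp.le, Real.log_sqrt hq.le] at h1
  have h2 := mul_le_mul_of_nonneg_left h1 hp.le
  have h3 : p * (√q / √p - 1) = √p * √q - p := by
    have := Real.mul_self_sqrt hp.le
    field_simp
    nlinarith
  rw [h3] at h2
  linarith

theorem two_mul_jointMass_sub_le (hE : IsPseudoexpectation D E)
    (hS : SatisfiesZero D E (spherePoly d)) (hk : 2 * (k + n) ≤ D)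
    (i : Fin k → Fin d) (α : Fin n → Fin d) :
    2 * (jointMass E i α - √(jointMass E i α) * √(productMass E i α)) ≤
      jointMass E i α * (Real.log (jointMass E i α) - (Real.log (wordMass E i) +
        ∑ r, (Real.log (letterMass E i (α r)) - Real.log (wordMass E i)))) := by
  rcases (jointMass_nonneg hE hk i α).eq_or_lt with h0 | h0
  · simp [← h0]
  · have hw : 0 < wordMass E i := h0.trans_le (jointMass_le_wordMass hE hS hk i α)
    have hl : ∀ r, 0 < letterMass E i (α r) := fun r =>
      h0.trans_le (jointMass_le_letterMass hE hS hk i α r)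
    have hl' : ∀ r, 0 < letterMass E i (α r) / wordMass E i := fun r => div_pos (hl r) hw
    have hprod : 0 < ∏ r, (letterMass E i (α r) / wordMass E i) :=
      Finset.prod_pos fun r _ => hl' r
    refine two_mul_sub_sqrt_le h0 (mul_pos hw hprod) ?_
    rw [productMass, Real.log_mul hw.ne' hprod.ne', Real.log_prod fun r _ => (hl' r).ne']
    congr 1
    exact Finset.sum_congr rfl fun r _ => (Real.log_div (hl r).ne' hw.ne').symm

/-- The right side is the conditional total correlation, that is, the relative entropy of the joint
law from the product law. Each log factor of the product depends on one letter, so its average is a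
single-letter entropy. -/
theorem sum_two_mul_jointMass_sub_le (hE : IsPseudoexpectation D E)
    (hS : SatisfiesZero D E (spherePoly d)) (hk : 2 * (k + n) ≤ D) :
    ∑ i : Fin k → Fin d, ∑ α : Fin n → Fin d,
        2 * (jointMass E i α - √(jointMass E i α) * √(productMass E i α)) ≤
      n * (wordEntropy E (k + 1) - wordEntropy E k)
        - (wordEntropy E (k + n) - wordEntropy E k) := by
  refine (Finset.sum_le_sum fun i _ => Finset.sum_le_sum fun α _ =>
    two_mul_jointMass_sub_le hE hS hk i α).trans_eq ?_
  rw [wordEntropy_succ, wordEntropy_add, wordEntropy]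
  simp only [← Finset.sum_sub_distrib, Finset.mul_sum]
  refine Finset.sum_congr rfl fun i _ => ?_
  have h1 : ∀ α : Fin n → Fin d, jointMass E i α * (Real.log (jointMass E i α) -
        (Real.log (wordMass E i) +
          ∑ r, (Real.log (letterMass E i (α r)) - Real.log (wordMass E i))))
      = -Real.negMulLog (jointMass E i α) - jointMass E i α * Real.log (wordMass E i)
        - ∑ r, (jointMass E i α * Real.log (letterMass E i (α r))
          - jointMass E i α * Real.log (wordMass E i)) := by
    intro α
    rw [Real.negMulLog]
    simp only [← mul_sub, ← Finset.mul_sum]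
    ring
  have h2 : ∑ α : Fin n → Fin d, ∑ r, (jointMass E i α * Real.log (letterMass E i (α r))
        - jointMass E i α * Real.log (wordMass E i))
      = n * (-(∑ a, Real.negMulLog (letterMass E i a)) + Real.negMulLog (wordMass E i)) := by
    rw [Finset.sum_comm]
    have : ∀ r : Fin n, ∑ α : Fin n → Fin d,
        (jointMass E i α * Real.log (letterMass E i (α r))
          - jointMass E i α * Real.log (wordMass E i))
        = -(∑ a, Real.negMulLog (letterMass E i a)) + Real.negMulLog (wordMass E i) := by
      intro r
      rw [Finset.sum_sub_distrib, ← Finset.sum_mul, sum_jointMass hS hk,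
        sum_mul_jointMass_letter hS hk i r (fun a => Real.log (letterMass E i a))]
      simp only [Real.negMulLog, neg_mul, Finset.sum_neg_distrib]
      ring
    simp [this, mul_add]
  rw [Finset.sum_congr rfl fun α _ => h1 α, Finset.sum_sub_distrib, Finset.sum_sub_distrib, h2,
    ← Finset.sum_mul, sum_jointMass hS hk, Finset.sum_neg_distrib]
  simp only [Real.negMulLog, neg_mul, Finset.sum_neg_distrib]
  ring

/-- Joint and product masses have the same total for each prefix, so the square expands to the
previous left side plus terms that cancel in the sum. -/
theorem sum_sq_sqrt_sub_sqrt_le (hE : IsPseudoexpectation D E)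
    (hS : SatisfiesZero D E (spherePoly d)) (hk : 2 * (k + n) ≤ D) (hk1 : 2 * (k + 1) ≤ D) :
    ∑ i : Fin k → Fin d, ∑ α : Fin n → Fin d, (√(jointMass E i α) - √(productMass E i α)) ^ 2 ≤
      n * (wordEntropy E (k + 1) - wordEntropy E k)
        - (wordEntropy E (k + n) - wordEntropy E k) := by
  refine le_trans (le_of_eq ?_) (sum_two_mul_jointMass_sub_le hE hS hk)
  refine Finset.sum_congr rfl fun i _ => ?_
  have h : ∀ α : Fin n → Fin d, (√(jointMass E i α) - √(productMass E i α)) ^ 2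
      = 2 * (jointMass E i α - √(jointMass E i α) * √(productMass E i α))
        + (productMass E i α - jointMass E i α) := by
    intro α
    rw [sub_sq, Real.sq_sqrt (jointMass_nonneg hE hk i α),
      Real.sq_sqrt (productMass_nonneg hE hk1 i α)]
    ring
  simp only [h]
  rw [Finset.sum_add_distrib, Finset.sum_sub_distrib, sum_productMass hS hk1,
    sum_jointMass hS hk, sub_self, add_zero]

end Hellinger

/-! ### The objective as a quadratic form -/

section Objective

variable {d t D k : ℕ} {M : Matrix (Fin t → Fin d) (Fin t → Fin d) ℝ}

/-- The quadratic form `∑ M_{αβ} u_α u_β`. -/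
noncomputable def quadForm {ι : Type*} [Fintype ι] (M : Matrix ι ι ℝ) (u : ι → ℝ) : ℝ :=
  ∑ α, ∑ β, M α β * (u α * u β)

theorem quadForm_eq_inner {ι : Type*} [Fintype ι] [DecidableEq ι] (M : Matrix ι ι ℝ)
    (u : EuclideanSpace ℝ ι) :
    quadForm M u = inner ℝ u (Matrix.toEuclideanCLM (n := ι) (𝕜 := ℝ) M u) := by
  simp only [quadForm, PiLp.inner_apply, Matrix.ofLp_toEuclideanCLM, Matrix.mulVec, dotProduct,
    RCLike.inner_apply, conj_trivial, Finset.sum_mul]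
  exact Finset.sum_congr rfl fun α _ => Finset.sum_congr rfl fun β _ => by ring

theorem quadForm_le_sum_sq {ι : Type*} [Fintype ι] [DecidableEq ι] {M : Matrix ι ι ℝ}
    (hM : ‖Matrix.toEuclideanCLM (n := ι) (𝕜 := ℝ) M‖ ≤ 1) (u : ι → ℝ) :
    quadForm M u ≤ ∑ α, u α ^ 2 := by
  have h := quadForm_eq_inner M (WithLp.toLp 2 u)
  set w : EuclideanSpace ℝ ι := WithLp.toLp 2 u with hw
  have h1 : ‖w‖ ^ 2 = ∑ α, u α ^ 2 := by
    rw [EuclideanSpace.norm_sq_eq]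
    simp [hw]
  change quadForm M u = _ at h
  rw [h, ← h1, sq]
  refine (real_inner_le_norm _ _).trans (mul_le_mul_of_nonneg_left ?_ (norm_nonneg _))
  exact (ContinuousLinearMap.le_of_opNorm_le _ hM w).trans_eq (one_mul _)

theorem quadForm_sub_le {ι : Type*} [Fintype ι] [DecidableEq ι] {M : Matrix ι ι ℝ}
    (hM : ‖Matrix.toEuclideanCLM (n := ι) (𝕜 := ℝ) M‖ ≤ 1) (u v : ι → ℝ) :
    quadForm M u - quadForm M v ≤
      √(∑ α, (u α - v α) ^ 2) * (√(∑ α, u α ^ 2) + √(∑ α, v α ^ 2)) := by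
  have hnorm : ∀ w : ι → ℝ, ‖(WithLp.toLp 2 w : EuclideanSpace ℝ ι)‖ = √(∑ α, w α ^ 2) := by
    intro w
    rw [EuclideanSpace.norm_eq]
    simp
  have hu := quadForm_eq_inner M (WithLp.toLp 2 u)
  have hv := quadForm_eq_inner M (WithLp.toLp 2 v)
  have huv := hnorm (u - v)
  rw [← hnorm u, ← hnorm v]
  simp only [Pi.sub_apply] at huv
  rw [← huv, WithLp.toLp_sub]
  set a : EuclideanSpace ℝ ι := WithLp.toLp 2 u
  set b : EuclideanSpace ℝ ι := WithLp.toLp 2 v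
  set T := Matrix.toEuclideanCLM (n := ι) (𝕜 := ℝ) M
  change quadForm M u = _ at hu
  change quadForm M v = _ at hv
  have hT : ∀ w, ‖T w‖ ≤ ‖w‖ := fun w =>
    (ContinuousLinearMap.le_of_opNorm_le _ hM w).trans_eq (one_mul _)
  -- Each term of the split carries one factor `a - b`, which gives a bound linear in the distance.
  have hsplit : inner ℝ a (T a) - inner ℝ b (T b)
      = inner ℝ (a - b) (T a) + inner ℝ b (T (a - b)) := by
    rw [map_sub, inner_sub_left, inner_sub_right]
    ring
  rw [hu, hv, hsplit]
  have h1 := (real_inner_le_norm (a - b) (T a)).trans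
    (mul_le_mul_of_nonneg_left (hT a) (norm_nonneg _))
  have h2 := (real_inner_le_norm b (T (a - b))).trans
    (mul_le_mul_of_nonneg_left (hT (a - b)) (norm_nonneg _))
  linarith

theorem tensorObjective_eq_quadForm (x : EuclideanSpace ℝ (Fin d)) :
    tensorObjective M x = quadForm M (fun α => ∏ r, x (α r)) := by
  simp only [tensorObjective, quadForm, tensorPow, Matrix.trace, Matrix.diag_apply,
    Matrix.mul_apply, Matrix.of_apply, Matrix.vecMulVec_apply, Finset.prod_mul_distrib]
  exact Finset.sum_congr rfl fun α _ => Finset.sum_congr rfl fun β _ => by ring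

theorem objectivePoly_eq_sum :
    objectivePoly M = ∑ α, ∑ β, C (M α β) * (wordMonomial α * wordMonomial β) := by
  simp only [objectivePoly, wordMonomial, tensorPow, Matrix.trace, Matrix.diag_apply,
    Matrix.mul_apply, Matrix.of_apply, Matrix.vecMulVec_apply, Finset.prod_mul_distrib,
    Matrix.map_apply]
  exact Finset.sum_congr rfl fun α _ => Finset.sum_congr rfl fun β _ => by ring

theorem eval_objectivePoly (x : EuclideanSpace ℝ (Fin d)) :
    eval (fun i => x i) (objectivePoly M) = tensorObjective M x := by
  rw [objectivePoly_eq_sum, tensorObjective_eq_quadForm]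
  simp [quadForm, wordMonomial]

theorem totalDegree_objectivePoly_sub_le (ν : ℝ) :
    (objectivePoly M - C ν).totalDegree ≤ 2 * t := by
  refine (totalDegree_sub _ _).trans (max_le ?_ (by simp))
  rw [objectivePoly_eq_sum]
  refine totalDegree_finsetSum_le fun α _ => totalDegree_finsetSum_le fun β _ => ?_
  refine (totalDegree_mul _ _).trans ?_
  have := totalDegree_wordMonomial_mul_le α β
  rw [totalDegree_C]
  omega

theorem sum_prod_sq (x : EuclideanSpace ℝ (Fin d)) :
    ∑ α : Fin t → Fin d, (∏ r, x (α r)) ^ 2 = (‖x‖ ^ 2) ^ t := by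
  rw [EuclideanSpace.norm_sq_eq, Fintype.sum_pow]
  simp [Finset.prod_pow]

theorem tensorObjective_le_one
    (hM : ‖Matrix.toEuclideanCLM (n := Fin t → Fin d) (𝕜 := ℝ) M‖ ≤ 1)
    {x : EuclideanSpace ℝ (Fin d)} (hx : ‖x‖ = 1) : tensorObjective M x ≤ 1 := by
  rw [tensorObjective_eq_quadForm]
  refine (quadForm_le_sum_sq hM _).trans_eq ?_
  rw [sum_prod_sq, hx]
  simp

/-- Evaluation at the point `x` is a pseudoexpectation of every degree. -/
theorem sosFeasible_of_le {x : EuclideanSpace ℝ (Fin d)} (hx : ‖x‖ = 1) {ν : ℝ}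
    (hν : ν ≤ tensorObjective M x) : SoSFeasible M D ν := by
  refine ⟨(aeval (fun i => x i) : MvPolynomial (Fin d) ℝ →ₐ[ℝ] ℝ).toLinearMap, ⟨by simp, ?_⟩,
    ?_, ?_⟩
  · intro Q _
    simp only [AlgHom.toLinearMap_apply, map_pow]
    positivity
  · intro Q _
    have h := eval_objectivePoly (M := M) x
    rw [← aeval_eq_eval] at h
    simp only [AlgHom.toLinearMap_apply, map_mul, map_pow, map_sub]
    refine mul_nonneg ?_ (sq_nonneg _)
    rw [aeval_C]
    simp only [Algebra.algebraMap_self, RingHom.id_apply]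
    have h' : aeval (fun i => x i) (objectivePoly M) = tensorObjective M x := h
    linarith
  · intro Q _
    have h : ∑ i, x i ^ 2 = 1 := by
      have := EuclideanSpace.norm_sq_eq x
      rw [hx] at this
      simpa using this.symm
    simp [spherePoly, h]

theorem pseudo_cauchy_schwarz {E : MvPolynomial (Fin d) ℝ →ₗ[ℝ] ℝ}
    (hE : IsPseudoexpectation D E) {f g : MvPolynomial (Fin d) ℝ}
    (hf : 2 * f.totalDegree ≤ D) (hg : 2 * g.totalDegree ≤ D) :
    E (f * g) ≤ √(E (f ^ 2)) * √(E (g ^ 2)) := by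
  -- The quadratic `x ↦ E ((x • f + g) ^ 2)` is nonnegative, so its discriminant is not positive.
  have h := discrim_le_zero (a := E (f ^ 2)) (b := 2 * E (f * g)) (c := E (g ^ 2)) fun x => by
    have h1 := hE.map_sq_nonneg (x • f + g) (by
      have h1 := totalDegree_add (x • f) g
      have h2 := totalDegree_smul_le x f
      omega)
    have h2 : (x • f + g) ^ 2 = (x * x) • f ^ 2 + (2 * x) • (f * g) + g ^ 2 := by
      simp only [smul_eq_C_mul, map_mul, map_ofNat]
      ring
    rw [h2, map_add, map_add, map_smul, map_smul, smul_eq_mul, smul_eq_mul] at h1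
    linarith
  rw [← Real.sqrt_mul (hE.map_sq_nonneg f hf)]
  refine Real.le_sqrt_of_sq_le ?_
  rw [discrim] at h
  linarith

theorem le_sum_quadForm_sqrt_jointMass (hM : ∀ α β, 0 ≤ M α β)
    {E : MvPolynomial (Fin d) ℝ →ₗ[ℝ] ℝ} (hE : IsPseudoexpectation D E)
    (hS : SatisfiesZero D E (spherePoly d)) {ν : ℝ}
    (hν : SatisfiesNonneg D E (objectivePoly M - C ν)) (hk : 2 * (k + t) ≤ D) :
    ν ≤ ∑ i : Fin k → Fin d, quadForm M (fun α => √(jointMass E i α)) := by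
  have h1 : ∀ i : Fin k → Fin d,
      ν * wordMass E i ≤ quadForm M (fun α => √(jointMass E i α)) := by
    intro i
    have h2 := hν (wordMonomial i) (by
      have := totalDegree_wordMonomial_le i
      have := totalDegree_objectivePoly_sub_le (M := M) ν
      omega)
    have h3 : (objectivePoly M - C ν) * wordMonomial i ^ 2
        = ∑ α, ∑ β, M α β • ((wordMonomial i * wordMonomial α) * (wordMonomial i * wordMonomial β))
          - ν • wordMonomial i ^ 2 := by
      rw [objectivePoly_eq_sum, sub_mul, Finset.sum_mul, smul_eq_C_mul]
      congr 1
      refine Finset.sum_congr rfl fun α _ => ?_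
      rw [Finset.sum_mul]
      refine Finset.sum_congr rfl fun β _ => ?_
      rw [smul_eq_C_mul]
      ring
    rw [h3, map_sub, map_smul, sub_nonneg, smul_eq_mul] at h2
    refine h2.trans ?_
    simp only [map_sum, map_smul, smul_eq_mul, quadForm]
    refine Finset.sum_le_sum fun α _ => Finset.sum_le_sum fun β _ =>
      mul_le_mul_of_nonneg_left ?_ (hM α β)
    have hα := totalDegree_wordMonomial_mul_le i α
    have hβ := totalDegree_wordMonomial_mul_le i β
    exact pseudo_cauchy_schwarz hE (by omega) (by omega)
  have h4 := Finset.sum_le_sum fun i (_ : i ∈ Finset.univ) => h1 i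
  rwa [← Finset.mul_sum, sum_wordMass hE hS (by omega), mul_one] at h4

theorem quadForm_sqrt_productMass_le {E : MvPolynomial (Fin d) ℝ →ₗ[ℝ] ℝ}
    (hE : IsPseudoexpectation D E) (hS : SatisfiesZero D E (spherePoly d)) {m : ℝ}
    (hm : ∀ x : EuclideanSpace ℝ (Fin d), ‖x‖ = 1 → tensorObjective M x ≤ m)
    (hk : 2 * (k + 1) ≤ D) (i : Fin k → Fin d) :
    quadForm M (fun α => √(productMass E i α)) ≤ wordMass E i * m := by
  rcases (wordMass_nonneg hE (by omega) i).eq_or_lt with h0 | h0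
  · simp [quadForm, productMass, ← h0]
  -- Square roots of the conditional letter probabilities form a unit vector, the candidate point at
  -- which the objective is compared with `m`.
  · set y : EuclideanSpace ℝ (Fin d) :=
      WithLp.toLp 2 fun a => √(letterMass E i a / wordMass E i) with hy
    have hyn : ∀ a, 0 ≤ letterMass E i a / wordMass E i := fun a =>
      div_nonneg (letterMass_nonneg hE hk i a) h0.le
    have hy1 : ‖y‖ = 1 := by
      rw [EuclideanSpace.norm_eq, Real.sqrt_eq_one]
      simp only [hy, Real.norm_eq_abs, sq_abs, Real.sq_sqrt (hyn _)]
      rw [← Finset.sum_div, sum_letterMass hS hk, div_self h0.ne']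
    have h1 : quadForm M (fun α => √(productMass E i α))
        = wordMass E i * tensorObjective M y := by
      rw [tensorObjective_eq_quadForm, quadForm, quadForm, Finset.mul_sum]
      refine Finset.sum_congr rfl fun α _ => ?_
      rw [Finset.mul_sum]
      refine Finset.sum_congr rfl fun β _ => ?_
      have h2 : ∀ α : Fin t → Fin d,
          √(productMass E i α) = √(wordMass E i) * ∏ r, y (α r) := by
        intro α
        rw [productMass, Real.sqrt_mul h0.le, Real.sqrt_prod _ fun r _ => hyn _]
      rw [h2, h2]
      have h3 := Real.mul_self_sqrt h0.le
      linear_combination (M α β * ((∏ r, y (α r)) * ∏ r, y (β r))) * h3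
    rw [h1]
    exact mul_le_mul_of_nonneg_left (hm y hy1) h0.le

theorem le_one_of_sosFeasible (hM0 : ∀ α β, 0 ≤ M α β)
    (hM : ‖Matrix.toEuclideanCLM (n := Fin t → Fin d) (𝕜 := ℝ) M‖ ≤ 1) (hD : 2 * t ≤ D)
    {ν : ℝ} (hν : SoSFeasible M D ν) : ν ≤ 1 := by
  obtain ⟨E, hE, hP, hS⟩ := hν
  have h := le_sum_quadForm_sqrt_jointMass (k := 0) hM0 hE hS hP (by omega)
  refine h.trans ?_
  refine (Finset.sum_le_sum fun i _ => quadForm_le_sum_sq hM _).trans_eq ?_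
  rw [← sum_wordMass (k := 0) hE hS (by omega)]
  refine Finset.sum_congr rfl fun i _ => ?_
  rw [← sum_jointMass (n := t) hS (by omega) i]
  exact Finset.sum_congr rfl fun α _ => Real.sq_sqrt (jointMass_nonneg hE (by omega) i α)

theorem le_add_two_mul_sqrt (hM0 : ∀ α β, 0 ≤ M α β)
    (hM : ‖Matrix.toEuclideanCLM (n := Fin t → Fin d) (𝕜 := ℝ) M‖ ≤ 1)
    {E : MvPolynomial (Fin d) ℝ →ₗ[ℝ] ℝ} (hE : IsPseudoexpectation D E)
    (hS : SatisfiesZero D E (spherePoly d)) {ν : ℝ}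
    (hν : SatisfiesNonneg D E (objectivePoly M - C ν)) {m : ℝ}
    (hm : ∀ x : EuclideanSpace ℝ (Fin d), ‖x‖ = 1 → tensorObjective M x ≤ m)
    (hk : 2 * (k + t) ≤ D) (hk1 : 2 * (k + 1) ≤ D) :
    ν ≤ m + 2 * √(t * (wordEntropy E (k + 1) - wordEntropy E k)
        - (wordEntropy E (k + t) - wordEntropy E k)) := by
  have h1 := le_sum_quadForm_sqrt_jointMass hM0 hE hS hν hk
  have h2 : ∑ i : Fin k → Fin d, quadForm M (fun α => √(productMass E i α)) ≤ m := by
    refine (Finset.sum_le_sum fun i _ => quadForm_sqrt_productMass_le hE hS hm hk1 i).trans_eq ?_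
    rw [← Finset.sum_mul, sum_wordMass hE hS (by omega), one_mul]
  have h3 : ∀ i : Fin k → Fin d, quadForm M (fun α => √(jointMass E i α))
      - quadForm M (fun α => √(productMass E i α))
      ≤ √(∑ α : Fin t → Fin d, (√(jointMass E i α) - √(productMass E i α)) ^ 2)
        * √(wordMass E i) * 2 := by
    intro i
    refine (quadForm_sub_le hM _ _).trans_eq ?_
    have e1 : ∑ α : Fin t → Fin d, √(jointMass E i α) ^ 2 = wordMass E i := by
      rw [← sum_jointMass hS hk i]
      exact Finset.sum_congr rfl fun α _ => Real.sq_sqrt (jointMass_nonneg hE hk i α)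
    have e2 : ∑ α : Fin t → Fin d, √(productMass E i α) ^ 2 = wordMass E i := by
      rw [← sum_productMass (n := t) hS hk1 i]
      exact Finset.sum_congr rfl fun α _ => Real.sq_sqrt (productMass_nonneg hE hk1 i α)
    rw [e1, e2]
    ring
  have h4 := Finset.sum_le_sum fun i (_ : i ∈ Finset.univ) => h3 i
  rw [Finset.sum_sub_distrib, ← Finset.sum_mul] at h4
  -- Cauchy–Schwarz over prefixes: their masses sum to one, so only the root of the total squared
  -- Hellinger distance remains.
  have h5 := Real.sum_sqrt_mul_sqrt_le Finset.univ
    (f := fun i : Fin k → Fin d =>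
      ∑ α : Fin t → Fin d, (√(jointMass E i α) - √(productMass E i α)) ^ 2)
    (fun i => Finset.sum_nonneg fun α _ => sq_nonneg _)
    (fun i => wordMass_nonneg hE (by omega : 2 * k ≤ D) i)
  rw [sum_wordMass hE hS (by omega), Real.sqrt_one, mul_one] at h5
  have h6 := Real.sqrt_le_sqrt (sum_sq_sqrt_sub_sqrt_le (k := k) (n := t) hE hS hk hk1)
  linarith

end Objective

/-! ### Choice of the prefix length -/

section Main

variable {d t D : ℕ} {M : Matrix (Fin t → Fin d) (Fin t → Fin d) ℝ}

/-- A feasible threshold exceeds the true maximum by at most `ε` once `D` admits conditioning on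
`K ≥ 4 t² log d / ε²` letters. -/
theorem le_add_of_sosFeasible_of_le (hd : 1 ≤ d) (hM0 : ∀ α β, 0 ≤ M α β)
    (hM : ‖Matrix.toEuclideanCLM (n := Fin t → Fin d) (𝕜 := ℝ) M‖ ≤ 1)
    {ν ε m : ℝ} (hε : 0 ≤ ε) (hν : SoSFeasible M D ν)
    (hm : ∀ x : EuclideanSpace ℝ (Fin d), ‖x‖ = 1 → tensorObjective M x ≤ m)
    {K : ℕ} (hK : 0 < K) (ht : 1 ≤ t) (hKD : 2 * (K + t) ≤ D + 2)
    (hKε : 4 * ((t : ℝ) ^ 2 * Real.log d) ≤ K * ε ^ 2) : ν ≤ m + ε := by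
  obtain ⟨E, hE, hP, hS⟩ := hν
  have hL : 0 ≤ Real.log d := Real.log_natCast_nonneg d
  have hsum := sum_total_correlation_le (wordEntropy E) t K (wordEntropy_zero hE)
    fun j hj => wordEntropy_le_add hE hS (by omega)
  have hbound : ∑ j ∈ Finset.range t, wordEntropy E j ≤ (t : ℝ) ^ 2 * Real.log d := by
    have h1 : ∀ j ∈ Finset.range t, wordEntropy E j ≤ t * Real.log d := by
      intro j hj
      have hj' := Finset.mem_range.1 hj
      refine (wordEntropy_le hd hE hS (by omega)).trans (mul_le_mul_of_nonneg_right ?_ hL)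
      exact_mod_cast hj'.le
    refine (Finset.sum_le_sum h1).trans_eq ?_
    simp only [Finset.sum_const, Finset.card_range, nsmul_eq_mul]
    ring
  -- Pigeonhole over `k < K`; the threshold `ε ^ 2 / 4` makes the error `2 * √(ε ^ 2 / 4) = ε`. As
  -- `k ≤ K - 1`, degree `2 * (K + t) - 2` suffices.
  obtain ⟨k, hk, hkle⟩ := Finset.exists_le_of_sum_le (s := Finset.range K)
    (g := fun _ => ε ^ 2 / 4) (Finset.nonempty_range_iff.2 hK.ne')
    (hsum.trans (hbound.trans (by
      simp only [Finset.sum_const, Finset.card_range, nsmul_eq_mul]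
      linarith)))
  have hk' := Finset.mem_range.1 hk
  refine (le_add_two_mul_sqrt (k := k) hM0 hM hE hS hP hm (by omega) (by omega)).trans ?_
  have h2 := Real.sqrt_le_sqrt hkle
  have h3 : √(ε ^ 2 / 4) = ε / 2 := by
    rw [show ε ^ 2 / 4 = (ε / 2) ^ 2 by ring, Real.sqrt_sq (by linarith)]
  rw [h3] at h2
  linarith

theorem le_of_sosFeasible_zero {M : Matrix (Fin 0 → Fin d) (Fin 0 → Fin d) ℝ}
    (hM0 : ∀ α β, 0 ≤ M α β) {ν : ℝ} (hν : SoSFeasible M D ν) (x : EuclideanSpace ℝ (Fin d)) :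
    ν ≤ tensorObjective M x := by
  obtain ⟨E, hE, hP, hS⟩ := hν
  refine (le_sum_quadForm_sqrt_jointMass (k := 0) hM0 hE hS hP (by omega)).trans_eq ?_
  simp [tensorObjective_eq_quadForm, quadForm, jointMass, wordMonomial, hE.map_one]

theorem le_add_of_sosFeasible (hd : 1 ≤ d) (hM0 : ∀ α β, 0 ≤ M α β)
    (hM : ‖Matrix.toEuclideanCLM (n := Fin t → Fin d) (𝕜 := ℝ) M‖ ≤ 1)
    {ν ε m : ℝ} (hε : 0 < ε) (hν : SoSFeasible M D ν) (hm0 : 0 ≤ m)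
    (hm : ∀ x : EuclideanSpace ℝ (Fin d), ‖x‖ = 1 → tensorObjective M x ≤ m)
    (hD : 2 * t ≤ D) (hDε : 16 * ((t : ℝ) ^ 2 * Real.log d / ε ^ 2) ≤ D) : ν ≤ m + ε := by
  rcases le_or_gt 1 ε with h1 | h1
  · linarith [le_one_of_sosFeasible hM0 hM hD hν]
  rcases Nat.eq_zero_or_pos t with rfl | ht
  · have h := le_of_sosFeasible_zero hM0 hν (EuclideanSpace.single (⟨0, hd⟩ : Fin d) (1 : ℝ))
    have := hm (EuclideanSpace.single (⟨0, hd⟩ : Fin d) (1 : ℝ)) (by simp)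
    linarith
  -- The largest `K` with `2 * (K + t) ≤ D + 2`.
  refine le_add_of_sosFeasible_of_le hd hM0 hM hε.le hν hm (K := D / 2 - t + 1) (by omega) ht
    (by omega) ?_
  rcases hd.eq_or_lt with rfl | hd2
  · simp only [Nat.cast_one, Real.log_one, mul_zero]
    positivity
  set L := Real.log d with hL
  have hL2 : (1 : ℝ) / 2 ≤ L := by
    have h2 : Real.log 2 ≤ L := Real.log_le_log (by norm_num) (by exact_mod_cast hd2)
    linarith [Real.log_two_gt_d9]
  have ht1 : (1 : ℝ) ≤ t := by exact_mod_cast ht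
  have hε2 : 0 < ε ^ 2 := by positivity
  have hε21 : ε ^ 2 ≤ 1 := pow_le_one₀ hε.le h1.le
  rw [← mul_div_assoc, div_le_iff₀ hε2] at hDε
  -- With `log d ≥ 1 / 2` and `ε < 1` the degree bound forces `D ≥ 8 * t`, hence `D ≤ 4 * K`; this
  -- loss of 4 turns the required 4 into the constant 16.
  have hDt : 8 * (t : ℝ) ≤ D := by
    have h3 : (D : ℝ) * ε ^ 2 ≤ D := mul_le_of_le_one_right (Nat.cast_nonneg D) hε21
    have h4 : (t : ℝ) ≤ t ^ 2 := by nlinarith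
    have h5 : (t : ℝ) ^ 2 * (1 / 2) ≤ t ^ 2 * L := mul_le_mul_of_nonneg_left hL2 (sq_nonneg _)
    linarith
  have hDt' : 8 * t ≤ D := by exact_mod_cast hDt
  have hK : (D : ℝ) ≤ 4 * ((D / 2 - t + 1 : ℕ) : ℝ) := by
    have : D ≤ 4 * (D / 2 - t + 1) := by omega
    exact_mod_cast this
  have h6 := mul_le_mul_of_nonneg_right hK hε2.le
  linarith

/-! ### Binary search and existence of the maximum -/

theorem sosSearch_width (n : ℕ) :
    ((sosSearch M D n).2 - (sosSearch M D n).1) * 2 ^ n = 1 := by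
  induction n with
  | zero => simp [sosSearch]
  | succ n ih =>
    rw [sosSearch]
    split_ifs <;> · rw [← ih]; ring

/-- The lower end is either the initial 0 or a threshold that tested feasible. -/
theorem sosSearch_lower {b : ℝ} (hb : 0 ≤ b) (h : ∀ ν, SoSFeasible M D ν → ν ≤ b) (n : ℕ) :
    (sosSearch M D n).1 ≤ b := by
  induction n with
  | zero => simpa [sosSearch] using hb
  | succ n ih =>
    rw [sosSearch]
    split_ifs with hf
    exacts [h _ hf, ih]

/-- The upper end is either the initial 1 or a threshold that tested infeasible, hence above `m`. -/
theorem sosSearch_upper {m : ℝ} (hm1 : m ≤ 1) (h : ∀ ν ≤ m, SoSFeasible M D ν) (n : ℕ) :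
    m ≤ (sosSearch M D n).2 := by
  induction n with
  | zero => simpa [sosSearch] using hm1
  | succ n ih =>
    rw [sosSearch]
    split_ifs with hf
    · exact ih
    · exact (lt_of_not_ge fun hle => hf (h _ hle)).le

theorem exists_isGreatest_tensorObjective (hd : 1 ≤ d) :
    ∃ x : EuclideanSpace ℝ (Fin d), ‖x‖ = 1 ∧
      ∀ y : EuclideanSpace ℝ (Fin d), ‖y‖ = 1 → tensorObjective M y ≤ tensorObjective M x := by
  have hcont : Continuous fun x : EuclideanSpace ℝ (Fin d) => tensorObjective M x := by
    simp only [tensorObjective_eq_quadForm, quadForm]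
    fun_prop
  obtain ⟨x, hx, hmax⟩ := (isCompact_sphere (0 : EuclideanSpace ℝ (Fin d)) 1).exists_isMaxOn
    ⟨EuclideanSpace.single (⟨0, hd⟩ : Fin d) (1 : ℝ), by simp⟩ hcont.continuousOn
  exact ⟨x, by simpa using hx, fun y hy => hmax (by simpa using hy)⟩

theorem tensorObjective_single_nonneg (hM0 : ∀ α β, 0 ≤ M α β) (a : Fin d) :
    0 ≤ tensorObjective M (EuclideanSpace.single a (1 : ℝ)) := by
  rw [tensorObjective_eq_quadForm]
  have h : ∀ b, 0 ≤ (EuclideanSpace.single a (1 : ℝ) : EuclideanSpace ℝ (Fin d)) b := by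
    intro b
    rw [PiLp.single_apply]
    split_ifs <;> norm_num
  exact Finset.sum_nonneg fun α _ => Finset.sum_nonneg fun β _ => mul_nonneg (hM0 α β)
    (mul_nonneg (Finset.prod_nonneg fun r _ => h _) (Finset.prod_nonneg fun r _ => h _))

end Main

end

theorem mainTheorem7 :
    ∃ C : ℝ, 0 < C ∧
      ∀ (d t : ℕ) (_ : 1 ≤ d) (M : Matrix (Fin t → Fin d) (Fin t → Fin d) ℝ)
        (_ : ∀ α β, 0 ≤ M α β) (_ : M.IsSymm)
        (_ : ‖Matrix.toEuclideanCLM (n := Fin t → Fin d) (𝕜 := ℝ) M‖ ≤ 1)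
        (ε : ℝ) (_ : 0 < ε)
        (D : ℕ) (_ : 2 * t ≤ D) (_ : C * ((t : ℝ) ^ 2 * Real.log d / ε ^ 2) ≤ D),
        ∃ m s : ℝ,
          IsGreatest (tensorObjective M '' {x : EuclideanSpace ℝ (Fin d) | ‖x‖ = 1}) m ∧
          IsLUB {ν : ℝ | SoSFeasible M D ν} s ∧
          m ≤ s ∧ s ≤ m + ε ∧
          ∀ n : ℕ, 1 ≤ ε * 2 ^ n → |sosAlgorithm M D n - m| ≤ ε := by
  refine ⟨16, by norm_num, ?_⟩
  intro d t hd M hM0 _ hM ε hε D hD hDε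
  obtain ⟨x, hx, hmax⟩ := exists_isGreatest_tensorObjective (M := M) hd
  have hm0 : 0 ≤ tensorObjective M x :=
    (tensorObjective_single_nonneg hM0 (⟨0, hd⟩ : Fin d)).trans (hmax _ (by simp))
  have hfeas : ∀ ν ≤ tensorObjective M x, SoSFeasible M D ν := fun ν hν => sosFeasible_of_le hx hν
  have hle : ∀ ν, SoSFeasible M D ν → ν ≤ tensorObjective M x + ε := fun ν hν =>
    le_add_of_sosFeasible hd hM0 hM hε hν hm0 hmax hD hDε
  obtain ⟨s, hs⟩ := Real.exists_isLUB (s := {ν : ℝ | SoSFeasible M D ν})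
    ⟨_, hfeas _ le_rfl⟩ ⟨_, hle⟩
  refine ⟨tensorObjective M x, s, ⟨⟨x, hx, rfl⟩, ?_⟩, hs, hs.1 (hfeas _ le_rfl), hs.2 hle, ?_⟩
  · rintro _ ⟨y, hy, rfl⟩
    exact hmax y hy
  · intro n hn
    have hw := sosSearch_width (M := M) (D := D) n
    have hlo := sosSearch_lower (by linarith) hle n
    have hhi := sosSearch_upper (tensorObjective_le_one hM hx) hfeas n
    have hwidth : (sosSearch M D n).2 - (sosSearch M D n).1 ≤ ε :=
      le_of_mul_le_mul_right (hw.trans_le hn) (by positivity)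
    rw [sosAlgorithm, abs_le]
    constructor <;> linarith
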